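/- Let $d\ge 1$ be an integer and let $\alpha=(\alpha_1,\dots,\alpha_d)$ be real numbers with $\alpha_i>-1$ for $i=1,\dots,d$. Put $S=\sum_{i=1}^d\alpha_i$ and $A=\prod_{i=1}^d(\alpha_i+1)$. Let $$\mathcal J_{\alpha}(z)=\sum_{n\ge 0}\frac{(-1)^n}{n!\,(\alpha_1+1)_n\cdots(\alpha_d+1)_n}\left(\frac{z}{d+1}\right)^{n(d+1)},\qquad J_{\alpha}(z)=\frac{\left(\frac{z}{d+1}\right)^{S}}{\Gamma(\alpha_1+1)\cdots\Gamma(\alpha_d+1)}\,\mathcal J_{\alpha}(z)\quad(z>0)$$ be the normalized hyper-Bessel function and the hyper-Bessel function, where $(\beta)_n=\beta(\beta+1)\cdots(\beta+n-1)$. Then $\mathcal J_\alpha$ has a smallest positive zero $j_{\alpha,1}$. Put $$q_{\alpha}(x)=\frac{x^{S/(d+1)}\,e^{-x/((d+1)^{d+1}A)}}{J_{\alpha}(x^{1/(d+1)})}\qquad\bigl(0<x<j_{\alpha,1}^{d+1}\bigr).$$ The limit $\lim_{x\to 0^+}q_\alpha(x)$ exists and equals $(d+1)^S\prod_{i=1}^d\Gamma(\alpha_i+1)$;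 let $q_\alpha(0)$ be this limit. Then $q_\alpha$ is positive on $[0,j_{\alpha,1}^{d+1})$, its logarithm is differentiable there (from the right at $0$), and, with $$h_{\alpha}(x)=\bigl(\log q_{\alpha}(x)\bigr)'\qquad\bigl(0\le x<j_{\alpha,1}^{d+1}\bigr),$$ both $h_\alpha$ and $q_\alpha$ are absolutely monotonic on $[0,j_{\alpha,1}^{d+1})$, that is, they are infinitely differentiable there and they and their derivatives of all orders are nonnegative (derivatives at $0$ being one-sided). -/

import Mathlib

open Set Filter Topology

namespace HyperBessel

noncomputable section

/-- The (real) generalized hypergeometric function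
`pFq(b₁,…,b_p; c₁,…,c_q; x) = ∑ₙ ((b₁)ₙ ⋯ (b_p)ₙ) / ((c₁)ₙ ⋯ (c_q)ₙ) · xⁿ / n!`,
where `(β)ₙ = β (β + 1) ⋯ (β + n - 1)` is the rising factorial. -/
def genHypergeometric {p q : ℕ} (b : Fin p → ℝ) (c : Fin q → ℝ) (x : ℝ) : ℝ :=
  ∑' n : ℕ, (∏ i, (ascPochhammer ℝ n).eval (b i)) / (∏ i, (ascPochhammer ℝ n).eval (c i)) *
    (x ^ n / (n.factorial : ℝ))

/-- The normalized hyper-Bessel function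
`z ↦ ₀F_d(-; α₁ + 1, …, α_d + 1; -(z / (d + 1)) ^ (d + 1))`. -/
def normHyperBessel {d : ℕ} (α : Fin d → ℝ) (z : ℝ) : ℝ :=
  genHypergeometric (![] : Fin 0 → ℝ) (fun i => α i + 1) (-(z / ((d : ℝ) + 1)) ^ (d + 1))

/-- `S(α) = α₁ + ⋯ + α_d`. -/
def sumParam {d : ℕ} (α : Fin d → ℝ) : ℝ := ∑ i, α i

/-- `A(α) = (α₁ + 1) ⋯ (α_d + 1)`. -/
def prodParam {d : ℕ} (α : Fin d → ℝ) : ℝ := ∏ i, (α i + 1)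

/-- The hyper-Bessel function of a positive real argument `z`:
`(z / (d + 1)) ^ (α₁ + ⋯ + α_d) / (Γ(α₁ + 1) ⋯ Γ(α_d + 1))` times the normalized function. -/
def hyperBessel {d : ℕ} (α : Fin d → ℝ) (z : ℝ) : ℝ :=
  (z / ((d : ℝ) + 1)) ^ sumParam α / (∏ i, Real.Gamma (α i + 1)) * normHyperBessel α z

/-- The set of positive zeros of the normalized hyper-Bessel function. -/
def positiveZeros {d : ℕ} (α : Fin d → ℝ) : Set ℝ := {z | 0 < z ∧ normHyperBessel α z = 0}

/-- The first positive zero of the normalized hyper-Bessel function. -/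
def firstZero {d : ℕ} (α : Fin d → ℝ) : ℝ := sInf (positiveZeros α)

/-- The quotient `x ^ (S / (d + 1)) e ^ (-x / ((d + 1) ^ (d + 1) A)) / J(x ^ (1 / (d + 1)))`,
meaningful for `x > 0`. -/
def quotientFormula {d : ℕ} (α : Fin d → ℝ) (x : ℝ) : ℝ :=
  x ^ (sumParam α / ((d : ℝ) + 1)) *
      Real.exp (-x / (((d : ℝ) + 1) ^ (d + 1) * prodParam α)) /
    hyperBessel α (x ^ (1 / ((d : ℝ) + 1)))

/-- The function `q` on `[0, ∞)`: the quotient above for `x ≠ 0`; at `x = 0`, where the formula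
has the form `0 / 0` or `∞ / ∞`, its limit from the right
`(d + 1) ^ S · Γ(α₁ + 1) ⋯ Γ(α_d + 1)`. -/
def qFun {d : ℕ} (α : Fin d → ℝ) (x : ℝ) : ℝ :=
  if x = 0 then ((d : ℝ) + 1) ^ sumParam α * ∏ i, Real.Gamma (α i + 1)
  else quotientFormula α x

/-- The function `h = (log q)'` on `[0, ∞)` (a one-sided derivative at `0`). -/
def hFun {d : ℕ} (α : Fin d → ℝ) (x : ℝ) : ℝ :=
  derivWithin (fun t => Real.log (qFun α t)) (Ici 0) x

end

end HyperBessel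

/-! In the variable x = z^(d+1) the normalized function becomes an entire function F with F(0) = 1.
Write -F'/F = ∑ σ_n x^n. Then h = -F'/F - σ_0 and q = q(0) e^(-σ_0 x)/F, so q' = h q. Both
assertions follow once every σ_n is nonnegative and F has no zero in the disc |x| < j^(d+1).

Formally σ_n is the sum of the (n+1)-st powers of the reciprocals of the zeros of F, which ought to
be positive. No factorization of F is used: F is a coefficientwise limit of polynomials with
distinct positive roots, for which the power-sum formula is elementary, and the inequalities in
`PowerSumBounds` survive the limit (`powerSumBounds_hypergeometric`). The polynomials start from
approximations of exp(-x). The factors 1/(α_i+1)_n are limits of products of multipliers 1 + n/c,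
each realized by p ↦ p + c⁻¹xp', which preserves positive roots by Rolle
(`HasPosRoots.add_X_mul_derivative`).

The growth inequality bounds the radius of convergence of ∑ σ_n x^n, so F has a zero. As 1/F has
nonnegative Taylor coefficients, Pringsheim's argument puts a zero of least modulus on the positive
axis (`exists_pos_zero_minimal_norm`). This gives the first zero and the zero-free disc together. -/

/-! ### Formal logarithmic derivatives. -/

/-- `σ` is the coefficient sequence of the formal power series `-A' / A`, where `a` is the
coefficient sequence of `A`. -/
def IsNegLogDeriv (a σ : ℕ → ℝ) : Prop :=
  ∀ n : ℕ, ((n : ℝ) + 1) * a (n + 1) = -∑ k ∈ Finset.range (n + 1), σ k * a (n - k)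

/-- The coefficients of `-A' / A`, for a formal power series `A` with constant coefficient `1`. -/
noncomputable def negLogDeriv (a : ℕ → ℝ) : ℕ → ℝ
  | n => -(((n : ℝ) + 1) * a (n + 1)) - ∑ k : Fin n, negLogDeriv a k * a (n - k)
decreasing_by exact k.2

theorem negLogDeriv_eq (a : ℕ → ℝ) (n : ℕ) :
    negLogDeriv a n = -(((n : ℝ) + 1) * a (n + 1)) -
      ∑ k ∈ Finset.range n, negLogDeriv a k * a (n - k) := by
  rw [negLogDeriv, Finset.sum_range]

theorem isNegLogDeriv_negLogDeriv {a : ℕ → ℝ} (ha : a 0 = 1) :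
    IsNegLogDeriv a (negLogDeriv a) := by
  intro n
  rw [Finset.sum_range_succ, negLogDeriv_eq a n]
  simp [ha]

theorem IsNegLogDeriv.eq_negLogDeriv {a σ : ℕ → ℝ} (h : IsNegLogDeriv a σ) (ha : a 0 = 1) :
    σ = negLogDeriv a := by
  funext n
  induction n using Nat.strong_induction_on with
  | _ n ih =>
    have := h n
    rw [Finset.sum_range_succ] at this
    rw [negLogDeriv_eq, ← Finset.sum_congr rfl
      (fun k hk => by rw [ih k (Finset.mem_range.1 hk)] : ∀ k ∈ Finset.range n,
        σ k * a (n - k) = negLogDeriv a k * a (n - k))]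
    simp only [Nat.sub_self, ha] at this
    linarith

/-- Each term is a polynomial in finitely many coefficients of `a`, so coefficientwise convergence
suffices and roots need not be followed to the limit. -/
theorem tendsto_negLogDeriv {ι : Type*} {l : Filter ι} {a : ι → ℕ → ℝ} {b : ℕ → ℝ}
    (h : ∀ n, Tendsto (fun i => a i n) l (𝓝 (b n))) (n : ℕ) :
    Tendsto (fun i => negLogDeriv (a i) n) l (𝓝 (negLogDeriv b n)) := by
  induction n using Nat.strong_induction_on with
  | _ n ih =>
    simp only [negLogDeriv_eq _ n]
    refine ((h (n + 1)).const_mul _).neg.sub (tendsto_finsetSum _ fun k hk => ?_)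
    exact (ih k (Finset.mem_range.1 hk)).mul (h _)

/-- A coefficient sequence is recovered continuously from that of its logarithmic derivative. -/
theorem tendsto_of_tendsto_negLogDeriv {ι : Type*} {l : Filter ι} {a σ : ι → ℕ → ℝ} {b τ : ℕ → ℝ}
    (ha : ∀ i, IsNegLogDeriv (a i) (σ i)) (hb : IsNegLogDeriv b τ)
    (ha0 : ∀ i, a i 0 = b 0)
    (h : ∀ n, Tendsto (fun i => σ i n) l (𝓝 (τ n))) (n : ℕ) :
    Tendsto (fun i => a i n) l (𝓝 (b n)) := by
  induction n using Nat.strong_induction_on with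
  | _ n ih =>
    cases n with
    | zero => simpa [ha0] using tendsto_const_nhds
    | succ n =>
      have hn : (n : ℝ) + 1 ≠ 0 := by positivity
      have e : ∀ {c ρ : ℕ → ℝ}, IsNegLogDeriv c ρ →
          c (n + 1) = ((n : ℝ) + 1)⁻¹ * -∑ k ∈ Finset.range (n + 1), ρ k * c (n - k) := by
        intro c ρ hc
        rw [← hc n, inv_mul_cancel_left₀ hn]
      rw [e hb]
      simp only [fun i => e (ha i)]
      refine (tendsto_finsetSum _ fun k _ => ?_).neg.const_mul _
      exact (h k).mul (ih _ (by omega))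

/-! ### Inequalities between power sums. -/

/-- The power sums of a summable family of positive reals satisfy these inequalities. -/
structure PowerSumBounds (σ : ℕ → ℝ) : Prop where
  nonneg : ∀ n, 0 ≤ σ n
  growth : ∀ n, σ 1 ^ (n + 1) ≤ σ n * σ 0 ^ (n + 1)

theorem PowerSumBounds.of_tendsto {ι : Type*} {l : Filter ι} [l.NeBot] {σ : ι → ℕ → ℝ}
    {τ : ℕ → ℝ} (h : ∀ n, Tendsto (fun i => σ i n) l (𝓝 (τ n)))
    (hσ : ∀ i, PowerSumBounds (σ i)) : PowerSumBounds τ where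
  nonneg n := ge_of_tendsto' (h n) fun i => (hσ i).nonneg n
  growth n := le_of_tendsto_of_tendsto' ((h 1).pow _) ((h n).mul ((h 0).pow _))
    fun i => (hσ i).growth n

/-- With m the largest element, σ_1 ≤ m σ_0 and m^(n+1) ≤ σ_n. -/
theorem powerSumBounds_finset (s : Finset ℝ) (hs : ∀ t ∈ s, 0 < t) :
    PowerSumBounds (fun n => ∑ t ∈ s, t ^ (n + 1)) where
  nonneg n := Finset.sum_nonneg fun t ht => pow_nonneg (hs t ht).le _
  growth n := by
    rcases s.eq_empty_or_nonempty with rfl | hne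
    · simp
    obtain ⟨m, hm, hmax⟩ := s.exists_max_image id hne
    have h0 : 0 ≤ ∑ t ∈ s, t ^ (0 + 1) := Finset.sum_nonneg fun t ht => pow_nonneg (hs t ht).le _
    have h1 : ∑ t ∈ s, t ^ (1 + 1) ≤ m * ∑ t ∈ s, t ^ (0 + 1) := by
      rw [Finset.mul_sum]
      refine Finset.sum_le_sum fun t ht => ?_
      have := mul_le_mul_of_nonneg_right (hmax t ht) (hs t ht).le
      simp only [id] at this
      rwa [zero_add, pow_one, one_add_one_eq_two, pow_two]
    calc (∑ t ∈ s, t ^ (1 + 1)) ^ (n + 1) ≤ (m * ∑ t ∈ s, t ^ (0 + 1)) ^ (n + 1) :=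
          pow_le_pow_left₀ (Finset.sum_nonneg fun t ht => pow_nonneg (hs t ht).le _) h1 _
      _ = m ^ (n + 1) * (∑ t ∈ s, t ^ (0 + 1)) ^ (n + 1) := mul_pow _ _ _
      _ ≤ _ := by
        refine mul_le_mul_of_nonneg_right ?_ (pow_nonneg h0 _)
        exact Finset.single_le_sum (f := fun t : ℝ => t ^ (n + 1))
          (fun t ht => pow_nonneg (hs t ht).le _) hm

/-- This is the substitution x ↦ cx; the chain rule supplies the extra factor c. -/
theorem IsNegLogDeriv.scale {a σ : ℕ → ℝ} (h : IsNegLogDeriv a σ) (c : ℝ) :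
    IsNegLogDeriv (fun n => a n * c ^ n) (fun n => σ n * c ^ (n + 1)) := by
  intro n
  rw [← mul_assoc, h n, neg_mul, Finset.sum_mul]
  congr 1
  refine Finset.sum_congr rfl fun k hk => ?_
  have : n + 1 = (k + 1) + (n - k) := by have := Finset.mem_range.1 hk; omega
  rw [this, pow_add]
  ring

theorem PowerSumBounds.scale {σ : ℕ → ℝ} (h : PowerSumBounds σ) {c : ℝ} (hc : 0 ≤ c) :
    PowerSumBounds (fun n => σ n * c ^ (n + 1)) where
  nonneg n := mul_nonneg (h.nonneg n) (pow_nonneg hc _)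
  growth n := by
    have := mul_le_mul_of_nonneg_right (h.growth n) (pow_nonneg hc (2 * (n + 1)))
    calc _ = σ 1 ^ (n + 1) * c ^ (2 * (n + 1)) := by
          rw [mul_pow, pow_mul]
      _ ≤ _ := this
      _ = _ := by rw [mul_pow, ← pow_mul, two_mul, pow_add]; ring

/-! ### Polynomials with positive roots and their coefficientwise limits. -/

section Polynomial

open Polynomial

theorem isNegLogDeriv_of_powerSeries {A S : PowerSeries ℝ}
    (h : PowerSeries.derivative ℝ A = -(S * A)) :
    IsNegLogDeriv (fun n => PowerSeries.coeff n A) (fun n => PowerSeries.coeff n S) := by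
  intro n
  have := congrArg (PowerSeries.coeff n) h
  rw [PowerSeries.coeff_derivative, map_neg, PowerSeries.coeff_mul,
    Finset.Nat.sum_antidiagonal_eq_sum_range_succ_mk] at this
  rw [← this, mul_comm]

/-- Each root contributes -1/(x - r) = ∑ r^(-n-1) x^n, so the coefficients are power sums of the
reciprocal roots. -/
theorem derivative_prod_X_sub_C (s : Finset ℝ) (hs : ∀ r ∈ s, r ≠ 0) (b : ℝ) :
    PowerSeries.derivative ℝ ((C b * ∏ r ∈ s, (X - C r) : ℝ[X]) : PowerSeries ℝ) =
      -((∑ r ∈ s, PowerSeries.mk fun n => r⁻¹ ^ (n + 1)) *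
        ((C b * ∏ r ∈ s, (X - C r) : ℝ[X]) : PowerSeries ℝ)) := by
  classical
  induction s using Finset.induction_on with
  | empty => simp
  | insert r s hr ih =>
    have hr0 : r ≠ 0 := hs r (Finset.mem_insert_self _ _)
    have key : PowerSeries.mk (fun n => r⁻¹ ^ (n + 1)) * (((X - C r : ℝ[X])) : PowerSeries ℝ)
        = -1 := by
      ext n
      rw [Polynomial.coe_sub, Polynomial.coe_X, Polynomial.coe_C, mul_sub, map_sub,
        PowerSeries.coeff_mul_C]
      cases n with
      | zero => simp [hr0]
      | succ n =>
        rw [PowerSeries.coeff_succ_mul_X]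
        simp only [PowerSeries.coeff_mk, map_neg, PowerSeries.coeff_one]
        simp [pow_succ, hr0]
    have e : (C b * ∏ r ∈ insert r s, (X - C r) : ℝ[X]) =
        (X - C r) * (C b * ∏ r ∈ s, (X - C r)) := by
      rw [Finset.prod_insert hr]; ring
    rw [e, Polynomial.coe_mul, Derivation.leibniz,
      ih fun t ht => hs t (Finset.mem_insert_of_mem ht), Finset.sum_insert hr,
      PowerSeries.derivative_coe, derivative_X_sub_C, Polynomial.coe_one]
    simp only [smul_eq_mul, mul_one]
    linear_combination ((C b * ∏ r ∈ s, (X - C r) : ℝ[X]) : PowerSeries ℝ) * key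

/-- A polynomial of degree at most `N` with `p(0) = 1` and `N` distinct positive roots. -/
structure HasPosRoots (N : ℕ) (p : ℝ[X]) : Prop where
  coeff_zero : p.coeff 0 = 1
  natDegree_le : p.natDegree ≤ N
  exists_roots : ∃ s : Finset ℝ, N ≤ s.card ∧ ∀ r ∈ s, 0 < r ∧ p.IsRoot r

theorem HasPosRoots.ne_zero {N : ℕ} {p : ℝ[X]} (h : HasPosRoots N p) : p ≠ 0 := by
  rintro rfl
  simpa using h.coeff_zero

/-- At least N distinct roots in degree at most N exhaust the root multiset, so the polynomial
splits with simple roots. -/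
theorem HasPosRoots.exists_eq {N : ℕ} {p : ℝ[X]} (h : HasPosRoots N p) :
    ∃ s : Finset ℝ, (∀ r ∈ s, 0 < r) ∧ p = C p.leadingCoeff * ∏ r ∈ s, (X - C r) := by
  classical
  obtain ⟨s, hcard, hs⟩ := h.exists_roots
  have hle : s.val ≤ p.roots := by
    rw [Multiset.le_iff_subset s.nodup]
    intro r hr
    exact (mem_roots h.ne_zero).2 (hs r hr).2
  have h1 := Multiset.card_le_card hle
  have h2 := p.card_roots'
  have h3 : Multiset.card s.val = s.card := rfl
  have h4 := h.natDegree_le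
  have heq : s.val = p.roots := Multiset.eq_of_le_of_card_le hle (by omega)
  refine ⟨s, fun r hr => (hs r hr).1, ?_⟩
  have := C_leadingCoeff_mul_prod_multiset_X_sub_C (p := p) (by omega)
  rw [← heq] at this
  exact this.symm

theorem HasPosRoots.powerSumBounds {N : ℕ} {p : ℝ[X]} (h : HasPosRoots N p) :
    PowerSumBounds (negLogDeriv p.coeff) := by
  classical
  obtain ⟨s, hs, hp⟩ := h.exists_eq
  have h1 := isNegLogDeriv_of_powerSeries
    (derivative_prod_X_sub_C s (fun r hr => (hs r hr).ne') p.leadingCoeff)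
  rw [← hp] at h1
  simp only [Polynomial.coeff_coe, map_sum, PowerSeries.coeff_mk] at h1
  rw [← h1.eq_negLogDeriv h.coeff_zero]
  have h2 := powerSumBounds_finset (s.image (·⁻¹)) (by
    intro t ht
    obtain ⟨r, hr, rfl⟩ := Finset.mem_image.1 ht
    exact inv_pos.2 (hs r hr))
  simpa [Finset.sum_image fun x _ y _ h => inv_injective h] using h2

/-- For `c > 0` the operator `p ↦ p + c⁻¹ X p'` preserves distinct positive roots. -/
theorem HasPosRoots.add_X_mul_derivative {N : ℕ} {p : ℝ[X]} (h : HasPosRoots N p) {c : ℝ}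
    (hc : 0 < c) : HasPosRoots N (p + C c⁻¹ * (X * derivative p)) := by
  classical
  set q := p + C c⁻¹ * (X * derivative p) with hq
  have hq0 : q.coeff 0 = 1 := by simp [hq, h.coeff_zero]
  have hqne : q ≠ 0 := by
    intro h0
    simp [h0] at hq0
  refine ⟨hq0, ?_, ?_⟩
  · refine natDegree_add_le_of_degree_le h.natDegree_le ?_
    refine (natDegree_C_mul_le _ _).trans ?_
    by_cases hp : p.natDegree = 0
    · rw [natDegree_eq_zero.1 hp |>.choose_spec.symm]
      simp
    · refine natDegree_mul_le.trans ?_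
      have h1 := natDegree_derivative_lt hp
      have h2 := h.natDegree_le
      have h3 : (X : ℝ[X]).natDegree ≤ 1 := natDegree_X_le
      omega
  · obtain ⟨s, hcard, hs⟩ := h.exists_roots
    refine ⟨q.roots.toFinset.filter (0 < ·), ?_, fun r hr => ?_⟩
    · have h0 : (0 : ℝ) ∉ s := fun h0 => lt_irrefl _ (hs 0 h0).1
      -- Since u^c p(u) also vanishes at 0, adding 0 to the roots gives as many gaps as there are
      -- roots, and Rolle loses none.
      have hroot : ∀ x ∈ insert 0 s, 0 ≤ x ∧ x ^ c * p.eval x = 0 := by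
        intro x hx
        rcases Finset.mem_insert.1 hx with rfl | hx
        · simp [Real.zero_rpow hc.ne']
        · exact ⟨(hs x hx).1.le, by rw [(hs x hx).2.eq_zero, mul_zero]⟩
      have := Finset.card_le_of_interleaved (s := insert 0 s)
        (t := q.roots.toFinset.filter (0 < ·)) ?_
      · rw [Finset.card_insert_of_notMem h0] at this
        omega
      intro x hx y hy hxy _
      obtain ⟨hx0, hx⟩ := hroot x hx
      obtain ⟨-, hy⟩ := hroot y hy
      -- For u > 0 the derivative of u^c p(u) is c u^(c-1) q(u), so Rolle's points are roots of q.
      obtain ⟨z, hz, hz'⟩ := exists_hasDerivAt_eq_zero (f := fun u : ℝ => u ^ c * p.eval u)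
        (f' := fun u => c * u ^ (c - 1) * p.eval u + u ^ c * (derivative p).eval u) hxy
        ((Real.continuous_rpow_const hc.le).mul p.continuous).continuousOn (hx.trans hy.symm)
        (fun u hu => (Real.hasDerivAt_rpow_const (Or.inl (hx0.trans_lt hu.1).ne')).mul
          (p.hasDerivAt u))
      have hz0 : 0 < z := hx0.trans_lt hz.1
      refine ⟨z, ?_, hz⟩
      rw [Finset.mem_filter, Multiset.mem_toFinset, mem_roots hqne]
      refine ⟨?_, hz0⟩
      have e : z ^ c = z ^ (c - 1) * z := by
        rw [← Real.rpow_add_one hz0.ne', sub_add_cancel]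
      rw [e] at hz'
      have hpos : 0 < z ^ (c - 1) := Real.rpow_pos_of_pos hz0 _
      have : z ^ (c - 1) * (c * q.eval z) = 0 := by
        rw [← hz', hq]
        simp only [eval_add, eval_mul, eval_C, eval_X]
        field_simp
      simpa [hpos.ne', hc.ne'] using this
    · rw [Finset.mem_filter, Multiset.mem_toFinset, mem_roots hqne] at hr
      exact ⟨hr.2, hr.1⟩

theorem coeff_add_X_mul_derivative (p : ℝ[X]) (c : ℝ) (n : ℕ) :
    (p + C c⁻¹ * (X * derivative p)).coeff n = p.coeff n * (1 + n / c) := by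
  cases n with
  | zero => simp
  | succ n =>
    rw [coeff_add, coeff_C_mul, coeff_X_mul, coeff_derivative]
    push_cast
    ring

theorem HasPosRoots.exists_multiplier {N : ℕ} {p : ℝ[X]} (h : HasPosRoots N p) {ι : Type*}
    (s : Finset ι) (c : ι → ℝ) (hc : ∀ i ∈ s, 0 < c i) :
    ∃ q, HasPosRoots N q ∧ ∀ n, q.coeff n = p.coeff n * ∏ i ∈ s, (1 + n / c i) := by
  classical
  induction s using Finset.induction_on with
  | empty => exact ⟨p, h, by simp⟩
  | insert j s hj ih =>
    obtain ⟨q, hq, hcoeff⟩ := ih fun i hi => hc i (Finset.mem_insert_of_mem hi)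
    refine ⟨_, hq.add_X_mul_derivative (hc j (Finset.mem_insert_self _ _)), fun n => ?_⟩
    rw [coeff_add_X_mul_derivative, hcoeff, Finset.prod_insert hj]
    ring

/-- There are polynomials with distinct positive roots converging coefficientwise, after
rescaling, to `exp (-x)`. -/
theorem exists_hasPosRoots_tendsto_exp :
    ∃ p : ℕ → ℝ[X], (∀ N, HasPosRoots N (p N)) ∧
      ∀ n, Tendsto (fun N => (p N).coeff n * (2 / (N : ℝ) ^ 2) ^ n) atTop
        (𝓝 ((-1) ^ n / (n.factorial : ℝ))) := by
  classical
  -- The reciprocal roots are 1, …, N. Their sum is about N²/2, so after scaling by 2/N² the first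
  -- power sum tends to 1 and the higher ones to 0.
  let s : ℕ → Finset ℝ := fun N => (Finset.range N).image fun i : ℕ => ((i : ℝ) + 1)⁻¹
  have hinj : Function.Injective fun i : ℕ => ((i : ℝ) + 1)⁻¹ := by
    intro i j hij
    simpa using hij
  have hs : ∀ N, ∀ r ∈ s N, 0 < r := by
    intro N r hr
    obtain ⟨i, -, rfl⟩ := Finset.mem_image.1 hr
    positivity
  let b : ℕ → ℝ := fun N => (∏ r ∈ s N, (-r))⁻¹
  let p : ℕ → ℝ[X] := fun N => C (b N) * ∏ r ∈ s N, (X - C r)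
  have hb : ∀ N, b N * ∏ r ∈ s N, (-r) = 1 := fun N => inv_mul_cancel₀ <|
    Finset.prod_ne_zero_iff.2 fun r hr => neg_ne_zero.2 (hs N r hr).ne'
  have hp : ∀ N, HasPosRoots N (p N) := by
    intro N
    refine ⟨?_, ?_, s N, ?_, fun r hr => ⟨hs N r hr, ?_⟩⟩
    · rw [coeff_zero_eq_eval_zero]
      simp [p, eval_prod, hb]
    · refine (natDegree_C_mul_le _ _).trans ?_
      rw [natDegree_prod_of_monic _ _ fun r _ => monic_X_sub_C r]
      simp [s, Finset.card_image_of_injective _ hinj]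
    · simp [s, Finset.card_image_of_injective _ hinj]
    · simp only [p, IsRoot.def, eval_mul, eval_prod]
      rw [Finset.prod_eq_zero hr (by simp), mul_zero]
  refine ⟨p, hp, ?_⟩
  have h1 : ∀ N, IsNegLogDeriv (p N).coeff (fun n => ∑ i ∈ Finset.range N, ((i : ℝ) + 1) ^ (n + 1)) := by
    intro N
    have := isNegLogDeriv_of_powerSeries
      (derivative_prod_X_sub_C (s N) (fun r hr => (hs N r hr).ne') (b N))
    simp only [Polynomial.coeff_coe, map_sum, PowerSeries.coeff_mk] at this
    simp only [s, Finset.sum_image fun x _ y _ h => hinj h, inv_inv] at this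
    exact this
  refine tendsto_of_tendsto_negLogDeriv (fun N => (h1 N).scale _)
    -- The series -A'/A for A = exp(-x) is the constant 1.
    (τ := fun n => if n = 0 then 1 else 0) ?_ ?_ ?_
  · intro n
    rw [Finset.sum_range_succ']
    simp only [Nat.add_eq_zero_iff, one_ne_zero, and_false, if_false, zero_mul,
      Finset.sum_const_zero, if_true, zero_add, one_mul, Nat.sub_zero, Nat.factorial_succ]
    push_cast
    field_simp
    ring
  · intro N
    simp [(hp N).coeff_zero]
  · have hsum : ∀ N : ℕ, ∑ i ∈ Finset.range N, ((i : ℝ) + 1) = N * (N + 1) / 2 := by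
      intro N
      induction N with
      | zero => simp
      | succ N ih => rw [Finset.sum_range_succ, ih]; push_cast; ring
    have hinv : Tendsto (fun N : ℕ => ((N : ℝ))⁻¹) atTop (𝓝 0) := tendsto_inv_atTop_nhds_zero_nat
    have h0 : Tendsto (fun N : ℕ => 1 + ((N : ℝ))⁻¹) atTop (𝓝 1) := by
      simpa using hinv.const_add 1
    intro n
    rcases Nat.eq_zero_or_pos n with rfl | hn
    · refine h0.congr' ?_
      filter_upwards [eventually_gt_atTop 0] with N hN
      have : (N : ℝ) ≠ 0 := by positivity
      simp only [zero_add, pow_one, hsum]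
      field_simp
    · rw [if_neg hn.ne']
      have hb : Tendsto (fun N : ℕ => (1 + ((N : ℝ))⁻¹) * (2 * ((N : ℝ))⁻¹) ^ n) atTop (𝓝 0) := by
        have := h0.mul ((hinv.const_mul 2).pow n)
        simpa [hn.ne'] using this
      refine squeeze_zero' (Eventually.of_forall fun N => by positivity) ?_ hb
      filter_upwards [eventually_gt_atTop 0] with N hN
      have hN' : (N : ℝ) ≠ 0 := by positivity
      calc (∑ i ∈ Finset.range N, ((i : ℝ) + 1) ^ (n + 1)) * (2 / (N : ℝ) ^ 2) ^ (n + 1)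
          ≤ (∑ i ∈ Finset.range N, ((i : ℝ) + 1) * (N : ℝ) ^ n) * (2 / (N : ℝ) ^ 2) ^ (n + 1) := by
            gcongr with i hi
            rw [pow_succ']
            gcongr
            exact_mod_cast Finset.mem_range.1 hi
        _ = _ := by
            rw [← Finset.sum_mul, hsum]
            have e : (2 * ((N : ℝ))⁻¹) ^ n = (N : ℝ) ^ n * (2 / (N : ℝ) ^ 2) ^ n := by
              rw [← mul_pow]
              congr 1
              field_simp
            rw [e, pow_succ]
            field_simp

/-- The product telescopes to (c+m)_n/(c)_n, which grows like m^n/(c)_n. -/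
theorem tendsto_prod_div_pow {c : ℝ} (hc : 0 < c) (n : ℕ) :
    Tendsto (fun m : ℕ => (∏ k ∈ Finset.range m, (1 + (n : ℝ) / (c + k))) * ((m : ℝ)⁻¹) ^ n) atTop
      (𝓝 ((ascPochhammer ℝ n).eval c)⁻¹) := by
  induction n with
  | zero => simp
  | succ n ih =>
    have hprod : ∀ m : ℕ, ∏ k ∈ Finset.range m, (1 + ((n + 1 : ℕ) : ℝ) / (c + k)) =
        (∏ k ∈ Finset.range m, (1 + (n : ℝ) / (c + k))) * ((c + n + m) / (c + n)) := by
      intro m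
      induction m with
      | zero => simp [show c + n ≠ 0 by positivity]
      | succ m ihm =>
        have h1 : c + m ≠ 0 := by positivity
        have h2 : c + n ≠ 0 := by positivity
        rw [Finset.prod_range_succ, Finset.prod_range_succ, ihm]
        push_cast
        field_simp
        ring
    have hlim : Tendsto (fun m : ℕ => ((c + n) * ((m : ℝ))⁻¹ + 1) * (c + n)⁻¹) atTop
        (𝓝 (((c + n) * 0 + 1) * (c + n)⁻¹)) :=
      ((tendsto_inv_atTop_nhds_zero_nat.const_mul _).add_const 1).mul_const _
    have := ih.mul hlim
    rw [mul_zero, zero_add, one_mul] at this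
    rw [ascPochhammer_succ_eval, mul_inv]
    refine this.congr' ?_
    filter_upwards [eventually_gt_atTop 0] with m hm
    have hm' : (m : ℝ) ≠ 0 := by positivity
    rw [hprod, pow_succ]
    field_simp

/-- The Taylor coefficients of `₀F_d(-; c₁, …, c_d; -l x)` with positive parameters
have a logarithmic derivative whose coefficients behave as power sums. -/
theorem powerSumBounds_hypergeometric {d : ℕ} (c : Fin d → ℝ) (hc : ∀ i, 0 < c i) {l : ℝ}
    (hl : 0 ≤ l) :
    PowerSumBounds (negLogDeriv fun n =>
      (-1) ^ n / (n.factorial : ℝ) * (∏ i, ((ascPochhammer ℝ n).eval (c i))⁻¹) * l ^ n) := by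
  obtain ⟨p, hp, hlim⟩ := exists_hasPosRoots_tendsto_exp
  have hex : ∀ m : ℕ, ∃ q, HasPosRoots m q ∧ ∀ n, q.coeff n = (p m).coeff n *
      ∏ i ∈ (Finset.univ : Finset (Fin d)) ×ˢ Finset.range m, (1 + (n : ℝ) / (c i.1 + i.2)) :=
    fun m => (hp m).exists_multiplier _ (fun i : Fin d × ℕ => c i.1 + i.2)
      fun i _ => add_pos_of_pos_of_nonneg (hc _) (Nat.cast_nonneg _)
  choose q hq hcoeff using hex
  -- The factor 2/m² normalizes the approximation of exp(-x), and each of the d Pochhammer products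
  -- needs one m⁻¹.
  let t : ℕ → ℝ := fun m => 2 / (m : ℝ) ^ 2 * ((m : ℝ)⁻¹) ^ d * l
  have ht : ∀ m, 0 ≤ t m := fun m => by positivity
  have hbd : ∀ m, PowerSumBounds (negLogDeriv fun n => (q m).coeff n * t m ^ n) := by
    intro m
    have h1 := (isNegLogDeriv_negLogDeriv (hq m).coeff_zero).scale (t m)
    rw [← h1.eq_negLogDeriv (by simp [(hq m).coeff_zero])]
    exact (hq m).powerSumBounds.scale (ht m)
  refine PowerSumBounds.of_tendsto (l := atTop) (tendsto_negLogDeriv fun n => ?_) hbd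
  have := ((hlim n).mul (tendsto_finsetProd Finset.univ fun i (_ : i ∈ Finset.univ) =>
    tendsto_prod_div_pow (hc i) n)).mul_const (l ^ n)
  refine this.congr fun m => ?_
  rw [hcoeff, Finset.prod_product, Finset.prod_mul_distrib]
  simp only [Finset.prod_const, Finset.card_univ, Fintype.card_fin, t, mul_pow]
  ring

end Polynomial

/-! ### Entire functions and nonnegative Taylor coefficients. -/

section Analytic

open scoped ComplexOrder Nat ContDiff

theorem hasFPowerSeriesOnBall_of_bound {a : ℕ → ℝ} {M : ℝ}
    (ha : ∀ n, |a n| ≤ M ^ n / n !) :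
    HasFPowerSeriesOnBall (fun z : ℂ => ∑' n, (a n : ℂ) * z ^ n)
      (FormalMultilinearSeries.ofScalars ℂ fun n => (a n : ℂ)) 0 ⊤ := by
  set p := FormalMultilinearSeries.ofScalars ℂ fun n => (a n : ℂ) with hp
  have hr : p.radius = ⊤ := by
    refine p.radius_eq_top_of_summable_norm fun r => ?_
    refine Summable.of_nonneg_of_le (fun n => by positivity) (fun n => ?_)
      (Real.summable_pow_div_factorial (M * r))
    rw [hp, FormalMultilinearSeries.ofScalars_norm, Complex.norm_real, Real.norm_eq_abs, mul_pow,
      mul_div_right_comm]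
    exact mul_le_mul_of_nonneg_right (ha n) (by positivity)
  have h := p.hasFPowerSeriesOnBall (by rw [hr]; exact ENNReal.zero_lt_top)
  rw [hr] at h
  convert! h using 1
  funext z
  simp [FormalMultilinearSeries.sum, hp, mul_comm]

theorem iteratedDeriv_zero_of_hasFPowerSeriesOnBall {F : ℂ → ℂ} {a : ℕ → ℂ}
    (h : HasFPowerSeriesOnBall F (FormalMultilinearSeries.ofScalars ℂ a) 0 ⊤) (n : ℕ) :
    iteratedDeriv n F 0 = n ! * a n := by
  rw [iteratedDeriv_eq_iteratedFDeriv, ← h.factorial_smul 1 n]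
  simp

/-- With G = -F'/F, the Leibniz rule for F' = -GF reproduces the recursion defining `negLogDeriv`.
-/
theorem iteratedDeriv_neg_logDeriv {F : ℂ → ℂ} {a : ℕ → ℝ} (hF : AnalyticAt ℂ F 0)
    (hFa : ∀ n, iteratedDeriv n F 0 = n ! * a n) (ha : a 0 = 1) (n : ℕ) :
    iteratedDeriv n (fun z => -deriv F z / F z) 0 = n ! * negLogDeriv a n := by
  have hF0 : F 0 ≠ 0 := by
    have := hFa 0
    simp only [iteratedDeriv_zero, ha] at this
    simp [this]
  have hG : AnalyticAt ℂ (fun z => -deriv F z / F z) 0 := hF.deriv.neg.div hF hF0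
  have heq : deriv F =ᶠ[𝓝 0] fun z => -((fun z => -deriv F z / F z) * F) z := by
    filter_upwards [hF.continuousAt.eventually_ne hF0] with z hz
    simp [hz]
  have key : ∀ n, ((n + 1)! : ℂ) * a (n + 1) = -∑ i ∈ Finset.range (n + 1),
      (n.choose i : ℂ) * iteratedDeriv i (fun z => -deriv F z / F z) 0 * ((n - i)! * a (n - i)) := by
    intro n
    rw [← hFa, iteratedDeriv_succ', heq.iteratedDeriv_eq, iteratedDeriv_fun_neg,
      iteratedDeriv_mul hG.contDiffAt hF.contDiffAt]
    simp only [hFa]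
  induction n using Nat.strong_induction_on with
  | _ n ih =>
    have := key n
    rw [Finset.sum_range_succ] at this
    have hn : (n ! : ℂ) ≠ 0 := by exact_mod_cast n.factorial_ne_zero
    have hs : ∑ i ∈ Finset.range n, (n.choose i : ℂ) *
        iteratedDeriv i (fun z => -deriv F z / F z) 0 * ((n - i)! * a (n - i)) =
        n ! * ∑ i ∈ Finset.range n, (negLogDeriv a i : ℂ) * a (n - i) := by
      rw [Finset.mul_sum]
      refine Finset.sum_congr rfl fun i hi => ?_
      have hi' := Finset.mem_range.1 hi
      rw [ih i hi', ← Nat.choose_mul_factorial_mul_factorial hi'.le]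
      push_cast
      ring
    rw [hs] at this
    simp only [Nat.choose_self, Nat.cast_one, one_mul, Nat.sub_self, Nat.factorial_zero, ha,
      Complex.ofReal_one, mul_one, Nat.factorial_succ, Nat.cast_mul] at this
    rw [negLogDeriv_eq]
    push_cast at this ⊢
    linear_combination this

theorem iteratedDeriv_nonneg_of_deriv_eq_mul {H Q : ℂ → ℂ} (hH : AnalyticAt ℂ H 0)
    (hQ : AnalyticAt ℂ Q 0) (h : deriv Q =ᶠ[𝓝 0] H * Q) (hQ0 : 0 ≤ Q 0)
    (hHn : ∀ n, 0 ≤ iteratedDeriv n H 0) (n : ℕ) : 0 ≤ iteratedDeriv n Q 0 := by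
  induction n using Nat.strong_induction_on with
  | _ n ih =>
    cases n with
    | zero => simpa using hQ0
    | succ n =>
      rw [iteratedDeriv_succ', h.iteratedDeriv_eq, iteratedDeriv_mul hH.contDiffAt hQ.contDiffAt]
      refine Finset.sum_nonneg fun i _ => ?_
      exact mul_nonneg (mul_nonneg (Nat.cast_nonneg _) (hHn i)) (ih _ (by omega))

/-- Triangle inequality on the Taylor series; this is the comparison behind Pringsheim's argument.
-/
theorem norm_le_re_of_iteratedDeriv_nonneg {Q : ℂ → ℂ} {R : ℝ}
    (hQ : DifferentiableOn ℂ Q (Metric.ball 0 R)) (hn : ∀ n, 0 ≤ iteratedDeriv n Q 0) {z : ℂ}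
    (hz : ‖z‖ < R) : ‖Q z‖ ≤ (Q (‖z‖ : ℝ)).re := by
  have h1 := Complex.hasSum_taylorSeries_on_ball hQ (z := z) (by simpa using hz)
  have h2 := Complex.hasSum_re (Complex.hasSum_taylorSeries_on_ball hQ (z := (‖z‖ : ℝ))
    (by simpa using hz))
  refine h1.norm_le_of_bounded h2 fun n => le_of_eq ?_
  obtain ⟨b, hb, hb'⟩ : ∃ b : ℝ, 0 ≤ b ∧ iteratedDeriv n Q 0 = b :=
    ⟨_, (Complex.nonneg_iff.1 (hn n)).1, Complex.eq_re_of_ofReal_le (by exact_mod_cast hn n)⟩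
  rw [hb']
  have : ((n ! : ℂ)⁻¹ • (((‖z‖ : ℝ) : ℂ) - 0) ^ n • (b : ℂ)).re = (n ! : ℝ)⁻¹ * (‖z‖ ^ n * b) := by
    rw [sub_zero, smul_eq_mul, smul_eq_mul]
    rw [← Complex.ofReal_pow, ← Complex.ofReal_mul, ← Complex.ofReal_natCast,
      ← Complex.ofReal_inv, ← Complex.ofReal_mul, Complex.ofReal_re]
  rw [this]
  simp [abs_of_nonneg hb]

/-- The zero of least modulus of an entire function whose negative logarithmic derivative has
power-sum-like Taylor coefficients is a positive real number. -/
theorem exists_pos_zero_minimal_norm {F : ℂ → ℂ} {a : ℕ → ℝ} (hF : Differentiable ℂ F)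
    (hFa : ∀ n, iteratedDeriv n F 0 = n ! * a n) (ha : a 0 = 1)
    (hσ : PowerSumBounds (negLogDeriv a)) (hσ1 : 0 < negLogDeriv a 1) :
    ∃ ρ : ℝ, 0 < ρ ∧ F ρ = 0 ∧ ∀ z : ℂ, ‖z‖ < ρ → F z ≠ 0 := by
  have hF0 : F 0 = 1 := by simpa [ha] using hFa 0
  have hGn := iteratedDeriv_neg_logDeriv (hF.analyticAt 0) hFa ha
  -- Without zeros -F'/F would be entire, so σ_n x^n → 0 for every x.
  have hne : (F ⁻¹' {0}).Nonempty := by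
    by_contra hempty
    have hnz : ∀ z, F z ≠ 0 := fun z hz => hempty ⟨z, hz⟩
    have hG : Differentiable ℂ fun z => -deriv F z / F z :=
      (hF.deriv).neg.div hF hnz
    have hσ0 : 0 < negLogDeriv a 0 := by
      refine lt_of_le_of_ne (hσ.nonneg 0) fun h => ?_
      have := hσ.growth 1
      rw [← h] at this
      simp only [ne_eq, Nat.add_eq_zero_iff, one_ne_zero, and_false, not_false_eq_true, zero_pow,
        mul_zero] at this
      exact absurd this (not_le.2 (by positivity))
    -- At this point the growth inequality reads σ_n x^(n+1) ≥ 1, so the terms cannot tend to 0.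
    set x : ℝ := negLogDeriv a 0 / negLogDeriv a 1 with hx
    have hx0 : 0 < x := div_pos hσ0 hσ1
    have h1 := (Complex.hasSum_taylorSeries_of_entire hG 0 (x : ℂ)).summable.tendsto_atTop_zero
    have h2 : Tendsto (fun n => negLogDeriv a n * x ^ n) atTop (𝓝 0) := by
      have := h1.norm
      rw [norm_zero] at this
      refine this.congr fun n => ?_
      have hn : (n ! : ℂ) ≠ 0 := by exact_mod_cast n.factorial_ne_zero
      rw [hGn, sub_zero, smul_eq_mul, smul_eq_mul,
        show (n ! : ℂ)⁻¹ * ((x : ℂ) ^ n * (n ! * negLogDeriv a n)) =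
          ((negLogDeriv a n * x ^ n : ℝ) : ℂ) by push_cast; field_simp, Complex.norm_real,
        Real.norm_of_nonneg (mul_nonneg (hσ.nonneg n) (by positivity))]
    have h3 : ∀ n, x⁻¹ ≤ negLogDeriv a n * x ^ n := by
      intro n
      have h4 : 1 ≤ negLogDeriv a n * x ^ (n + 1) := by
        rw [hx, div_pow, ← mul_div_assoc, le_div_iff₀ (by positivity), one_mul]
        exact hσ.growth n
      rw [inv_le_iff_one_le_mul₀ hx0]
      calc 1 ≤ _ := h4
        _ = _ := by ring
    exact absurd (ge_of_tendsto' h2 h3) (not_le.2 (inv_pos.2 hx0))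
  obtain ⟨z₀, hz₀, hmin⟩ := (isClosed_singleton.preimage hF.continuous).exists_infDist_eq_dist hne 0
  have hz₀' : F z₀ = 0 := hz₀
  have hρ : 0 < ‖z₀‖ := by
    refine norm_pos_iff.2 fun h => ?_
    rw [h, hF0] at hz₀'
    exact one_ne_zero hz₀'
  have hnz : ∀ z : ℂ, ‖z‖ < ‖z₀‖ → F z ≠ 0 := by
    intro z hz h
    have := Metric.infDist_le_dist_of_mem (x := (0 : ℂ)) (s := F ⁻¹' {0}) (y := z) h
    rw [hmin, dist_zero_left, dist_zero_left] at this
    linarith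
  refine ⟨‖z₀‖, hρ, ?_, hnz⟩
  -- (1/F)' = (-F'/F)(1/F), and both -F'/F and F(0) = 1 have the right signs.
  have hinv : ∀ n, 0 ≤ iteratedDeriv n (fun z => (F z)⁻¹) 0 := by
    have hF0' : F 0 ≠ 0 := by simp [hF0]
    refine iteratedDeriv_nonneg_of_deriv_eq_mul
      ((hF.analyticAt 0).deriv.neg.div (hF.analyticAt 0) hF0') ((hF.analyticAt 0).inv hF0') ?_
      (by simp [hF0]) fun n => ?_
    · filter_upwards [hF.continuous.continuousAt.eventually_ne hF0'] with z hz
      rw [((hF z).hasDerivAt.fun_inv hz).deriv]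
      simp only [Pi.mul_apply, Pi.div_apply, Pi.neg_apply]
      field_simp
    · refine le_of_le_of_eq ?_ (hGn n).symm
      exact mul_nonneg (Nat.cast_nonneg _) (by exact_mod_cast hσ.nonneg n)
  have hdiff : DifferentiableOn ℂ (fun z => (F z)⁻¹) (Metric.ball 0 ‖z₀‖) :=
    hF.differentiableOn.inv fun z hz => hnz z (by simpa using hz)
  -- Since |1/F(z)| ≤ 1/F(|z|) inside the disc, letting t → 1 transfers the zero at z₀ to ‖z₀‖.
  have hle : ∀ t ∈ Ioo (0 : ℝ) 1, ‖F ((t * ‖z₀‖ : ℝ) : ℂ)‖ ≤ ‖F (t * z₀)‖ := by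
    intro t ht
    have hnorm : ‖(t : ℂ) * z₀‖ = t * ‖z₀‖ := by
      rw [norm_mul, Complex.norm_real, Real.norm_of_nonneg ht.1.le]
    have hlt : ‖(t : ℂ) * z₀‖ < ‖z₀‖ := by
      rw [hnorm]
      nlinarith [ht.2]
    have := (norm_le_re_of_iteratedDeriv_nonneg hdiff hinv hlt).trans (Complex.re_le_norm _)
    rw [hnorm, norm_inv, norm_inv] at this
    refine (inv_le_inv₀ (norm_pos_iff.2 (hnz _ hlt)) (norm_pos_iff.2 (hnz _ ?_))).1 this
    rw [Complex.norm_real, Real.norm_of_nonneg (by have := ht.1; positivity), ← hnorm]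
    exact hlt
  have hl : Tendsto (fun t : ℝ => ‖F ((t * ‖z₀‖ : ℝ) : ℂ)‖) (𝓝[<] 1) (𝓝 ‖F ((1 * ‖z₀‖ : ℝ) : ℂ)‖) :=
    ((hF.continuous.comp (Complex.continuous_ofReal.comp
      (continuous_id.mul continuous_const))).norm.tendsto 1).mono_left nhdsWithin_le_nhds
  have hr : Tendsto (fun t : ℝ => ‖F (t * z₀)‖) (𝓝[<] 1) (𝓝 ‖F ((1 : ℝ) * z₀)‖) :=
    ((hF.continuous.comp (Complex.continuous_ofReal.mul continuous_const)).norm.tendsto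
      (1 : ℝ)).mono_left nhdsWithin_le_nhds
  have := le_of_tendsto_of_tendsto hl hr (by
    filter_upwards [Ioo_mem_nhdsLT (zero_lt_one' ℝ)] with t ht using hle t ht)
  rw [one_mul, Complex.ofReal_one, one_mul, hz₀', norm_zero] at this
  exact norm_le_zero_iff.1 this

theorem analyticAt_iteratedDeriv {Q : ℂ → ℂ} {z : ℂ} (hQ : AnalyticAt ℂ Q z) (n : ℕ) :
    AnalyticAt ℂ (iteratedDeriv n Q) z := by
  rw [iteratedDeriv_eq_iterate]
  exact hQ.iterated_deriv n

theorem iteratedDeriv_re_ofReal {Q : ℂ → ℂ} {R : ℝ}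
    (hQ : DifferentiableOn ℂ Q (Metric.ball 0 R)) (n : ℕ) {x : ℝ} (hx : |x| < R) :
    iteratedDeriv n (fun t : ℝ => (Q t).re) x = (iteratedDeriv n Q x).re := by
  induction n generalizing x with
  | zero => simp
  | succ n ih =>
    have hmem : (x : ℂ) ∈ Metric.ball (0 : ℂ) R := by simpa using hx
    have han : AnalyticAt ℂ Q x := hQ.analyticAt (Metric.isOpen_ball.mem_nhds hmem)
    rw [iteratedDeriv_succ, iteratedDeriv_succ]
    have heq : iteratedDeriv n (fun t : ℝ => (Q t).re) =ᶠ[𝓝 x]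
        fun t : ℝ => (iteratedDeriv n Q t).re := by
      filter_upwards [continuous_abs.continuousAt.eventually_lt continuousAt_const hx] with t ht
        using ih ht
    rw [heq.deriv_eq]
    exact ((analyticAt_iteratedDeriv han n).differentiableAt.hasDerivAt.real_of_complex).deriv

/-- A function given on `[0, R)` by a power series with nonnegative coefficients is absolutely
monotone there. -/
theorem absolutelyMonotoneOn_of_iteratedDeriv_nonneg {Q : ℂ → ℂ} {R : ℝ}
    (hQ : DifferentiableOn ℂ Q (Metric.ball 0 R)) (hn : ∀ n, 0 ≤ iteratedDeriv n Q 0)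
    {f : ℝ → ℝ} (hf : ∀ x ∈ Ico 0 R, f x = (Q x).re) :
    AbsolutelyMonotoneOn f (Ico 0 R) := by
  have hcd : ∀ x ∈ Ico 0 R, ContDiffAt ℝ ∞ (fun t : ℝ => (Q t).re) x := by
    intro x hx
    have hmem : (x : ℂ) ∈ Metric.ball (0 : ℂ) R := by simpa [abs_of_nonneg hx.1] using hx.2
    exact (hQ.analyticAt (Metric.isOpen_ball.mem_nhds hmem)).contDiffAt.real_of_complex
  rw [AbsolutelyMonotoneOn.iff_iteratedDerivWithin_nonneg (uniqueDiffOn_Ico 0 R)]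
  refine ⟨ContDiffOn.congr (fun x hx => (hcd x hx).contDiffWithinAt) hf, fun n x hx => ?_⟩
  rw [iteratedDerivWithin_congr (g := fun t : ℝ => (Q t).re) hf hx,
    iteratedDerivWithin_eq_iteratedDeriv (uniqueDiffOn_Ico 0 R)
      ((hcd x hx).of_le (by exact_mod_cast le_top)) hx,
    iteratedDeriv_re_ofReal hQ n (by rw [abs_of_nonneg hx.1]; exact hx.2)]
  have hmem : (x : ℂ) ∈ Metric.ball (0 : ℂ) R := by simpa [abs_of_nonneg hx.1] using hx.2
  have hd : DifferentiableOn ℂ (iteratedDeriv n Q) (Metric.ball 0 R) := fun z hz =>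
    (analyticAt_iteratedDeriv (hQ.analyticAt (Metric.isOpen_ball.mem_nhds hz))
      n).differentiableAt.differentiableWithinAt
  have := hd.nonneg_of_iteratedDeriv_nonneg (c := 0) (fun m => ?_) (z := (x : ℂ))
    (by exact_mod_cast hx.1) hmem
  · exact (Complex.nonneg_iff.1 this).1
  -- The Taylor coefficients of the n-th derivative at 0 are nonnegative too, hence so are its
  -- values on [0, R).
  · have h := hn (m + n)
    rwa [iteratedDeriv_eq_iterate, Function.iterate_add_apply, ← iteratedDeriv_eq_iterate,
      ← iteratedDeriv_eq_iterate] at h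

end Analytic

/-! ### The hyper-Bessel function in the variable x = z^(d+1). -/

namespace HyperBessel

section

open scoped ComplexOrder Nat

/-- The Taylor coefficients of `₀F_d(-; α₁ + 1, …, α_d + 1; -x / (d + 1) ^ (d + 1))`. -/
noncomputable def taylorCoeff {d : ℕ} (α : Fin d → ℝ) (n : ℕ) : ℝ :=
  (-1) ^ n / (n ! : ℝ) * (∏ i, ((ascPochhammer ℝ n).eval (α i + 1))⁻¹) *
    (((d : ℝ) + 1) ^ (d + 1))⁻¹ ^ n

/-- The entire function `₀F_d(-; α₁ + 1, …, α_d + 1; -z / (d + 1) ^ (d + 1))`. -/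
noncomputable def entireFun {d : ℕ} (α : Fin d → ℝ) (z : ℂ) : ℂ :=
  ∑' n, (taylorCoeff α n : ℂ) * z ^ n

/-- The first coefficient `1 / ((d + 1) ^ (d + 1) A)` of the negative logarithmic derivative. -/
noncomputable def rate {d : ℕ} (α : Fin d → ℝ) : ℝ :=
  (((d : ℝ) + 1) ^ (d + 1) * prodParam α)⁻¹

variable {d : ℕ} {α : Fin d → ℝ}

theorem taylorCoeff_zero : taylorCoeff α 0 = 1 := by simp [taylorCoeff]

theorem pow_le_ascPochhammer_eval {c : ℝ} (hc : 0 < c) (n : ℕ) :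
    c ^ n ≤ (ascPochhammer ℝ n).eval c := by
  induction n with
  | zero => simp
  | succ n ih =>
    rw [ascPochhammer_succ_eval, pow_succ]
    have h0 := (pow_nonneg hc.le n).trans ih
    have : c ≤ c + n := by simp
    gcongr

theorem abs_taylorCoeff_le (hα : ∀ i, -1 < α i) (n : ℕ) :
    |taylorCoeff α n| ≤ rate α ^ n / n ! := by
  have hc : ∀ i, 0 < α i + 1 := fun i => by linarith [hα i]
  have h1 : ∀ i, 0 < (ascPochhammer ℝ n).eval (α i + 1) := fun i => ascPochhammer_pos n _ (hc i)
  have hp : 0 ≤ ∏ i, ((ascPochhammer ℝ n).eval (α i + 1))⁻¹ :=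
    Finset.prod_nonneg fun i _ => (inv_pos.2 (h1 i)).le
  have hle : ∏ i, ((ascPochhammer ℝ n).eval (α i + 1))⁻¹ ≤ (prodParam α)⁻¹ ^ n := by
    rw [prodParam, ← Finset.prod_inv_distrib, ← Finset.prod_pow]
    refine Finset.prod_le_prod (fun i _ => (inv_pos.2 (h1 i)).le) fun i _ => ?_
    rw [inv_pow]
    exact inv_anti₀ (pow_pos (hc i) n) (pow_le_ascPochhammer_eval (hc i) n)
  have hl : (0 : ℝ) ≤ (((d : ℝ) + 1) ^ (d + 1))⁻¹ ^ n := by positivity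
  rw [taylorCoeff, abs_mul, abs_mul, abs_div, abs_pow, abs_neg, abs_one, one_pow, Nat.abs_cast,
    abs_of_nonneg hp, abs_of_nonneg hl, rate, mul_inv, mul_pow]
  calc _ ≤ 1 / (n ! : ℝ) * (prodParam α)⁻¹ ^ n * (((d : ℝ) + 1) ^ (d + 1))⁻¹ ^ n := by gcongr
    _ = _ := by ring

theorem hasFPowerSeriesOnBall_entireFun (hα : ∀ i, -1 < α i) :
    HasFPowerSeriesOnBall (entireFun α)
      (FormalMultilinearSeries.ofScalars ℂ fun n => (taylorCoeff α n : ℂ)) 0 ⊤ :=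
  hasFPowerSeriesOnBall_of_bound (abs_taylorCoeff_le hα)

theorem differentiable_entireFun (hα : ∀ i, -1 < α i) : Differentiable ℂ (entireFun α) := fun z =>
  ((hasFPowerSeriesOnBall_entireFun hα).analyticOnNhd z (by simp)).differentiableAt

theorem entireFun_ofReal_pow (z : ℝ) :
    entireFun α ((z ^ (d + 1) : ℝ) : ℂ) = normHyperBessel α z := by
  rw [entireFun, normHyperBessel, genHypergeometric, Complex.ofReal_tsum]
  refine tsum_congr fun n => ?_
  rw [← Complex.ofReal_pow, ← Complex.ofReal_mul]
  congr 1
  rw [taylorCoeff, Finset.prod_inv_distrib, neg_pow ((z / ((d : ℝ) + 1)) ^ (d + 1)) n, div_pow,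
    div_pow]
  simp only [Finset.univ_eq_empty, Finset.prod_empty]
  ring

theorem negLogDeriv_taylorCoeff_zero : negLogDeriv (taylorCoeff α) 0 = rate α := by
  rw [negLogDeriv_eq]
  simp [taylorCoeff, rate, prodParam, Finset.prod_inv_distrib]

/-- Strictness needs d ≥ 1: for d = 0 both products are empty, σ_1 = 0, and the function is exp(-x),
which has no zero. -/
theorem negLogDeriv_taylorCoeff_one_pos (hd : 1 ≤ d) (hα : ∀ i, -1 < α i) :
    0 < negLogDeriv (taylorCoeff α) 1 := by
  have hc : ∀ i, 0 < α i + 1 := fun i => by linarith [hα i]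
  have : Nonempty (Fin d) := ⟨⟨0, hd⟩⟩
  have h1 : ∏ i, (α i + 1 + 1)⁻¹ < ∏ i, (α i + 1)⁻¹ :=
    Finset.prod_lt_prod_of_nonempty (fun i _ => inv_pos.2 (by linarith [hc i]))
      (fun i _ => inv_strictAnti₀ (hc i) (by linarith)) Finset.univ_nonempty
  have h2 : 0 < ∏ i, (α i + 1)⁻¹ := Finset.prod_pos fun i _ => inv_pos.2 (hc i)
  have h3 : (0 : ℝ) < (((d : ℝ) + 1) ^ (d + 1))⁻¹ := by positivity
  have e1 : taylorCoeff α 1 = -(∏ i, (α i + 1)⁻¹) * (((d : ℝ) + 1) ^ (d + 1))⁻¹ := by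
    simp [taylorCoeff]
  have e2 : taylorCoeff α 2 = 2⁻¹ * ((∏ i, (α i + 1)⁻¹) * ∏ i, (α i + 1 + 1)⁻¹) *
      (((d : ℝ) + 1) ^ (d + 1))⁻¹ ^ 2 := by
    rw [taylorCoeff, ← Finset.prod_mul_distrib]
    simp [ascPochhammer_succ_eval, mul_comm, Nat.factorial]
  have e : negLogDeriv (taylorCoeff α) 1 = (((d : ℝ) + 1) ^ (d + 1))⁻¹ ^ 2 *
      (∏ i, (α i + 1)⁻¹) * (∏ i, (α i + 1)⁻¹ - ∏ i, (α i + 1 + 1)⁻¹) := by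
    rw [negLogDeriv_eq, Finset.sum_range_one, negLogDeriv_eq, Finset.sum_range_zero]
    norm_num only [Nat.cast_one, Nat.cast_zero]
    rw [e1, e2]
    ring
  rw [e]
  have := sub_pos.2 h1
  positivity

theorem powerSumBounds_taylorCoeff (hα : ∀ i, -1 < α i) :
    PowerSumBounds (negLogDeriv (taylorCoeff α)) :=
  powerSumBounds_hypergeometric (fun i => α i + 1) (fun i => by linarith [hα i]) (by positivity)

/-- The holomorphic extension of `h`. -/
noncomputable def hExt (α : Fin d → ℝ) (z : ℂ) : ℂ :=
  -deriv (entireFun α) z / entireFun α z - rate α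

/-- The holomorphic extension of `q / q(0)`. -/
noncomputable def qExt (α : Fin d → ℝ) (z : ℂ) : ℂ :=
  Complex.exp (-(rate α * z)) / entireFun α z

theorem iteratedDeriv_entireFun (hα : ∀ i, -1 < α i) (n : ℕ) :
    iteratedDeriv n (entireFun α) 0 = n ! * taylorCoeff α n :=
  iteratedDeriv_zero_of_hasFPowerSeriesOnBall (hasFPowerSeriesOnBall_entireFun hα) n

theorem entireFun_zero (hα : ∀ i, -1 < α i) : entireFun α 0 = 1 := by
  simpa [taylorCoeff_zero] using iteratedDeriv_entireFun hα 0

theorem differentiableAt_hExt (hα : ∀ i, -1 < α i) {z : ℂ} (hz : entireFun α z ≠ 0) :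
    DifferentiableAt ℂ (hExt α) z :=
  (((differentiable_entireFun hα).deriv z).neg.div (differentiable_entireFun hα z) hz).sub_const _

theorem hasDerivAt_qExt (hα : ∀ i, -1 < α i) {z : ℂ} (hz : entireFun α z ≠ 0) :
    HasDerivAt (qExt α) (hExt α z * qExt α z) z := by
  have h1 : HasDerivAt (fun z : ℂ => Complex.exp (-(rate α * z)))
      (Complex.exp (-(rate α * z)) * -(rate α * 1)) z :=
    ((hasDerivAt_id z).const_mul _).neg.cexp
  convert! h1.div (differentiable_entireFun hα z).hasDerivAt hz using 1
  rw [hExt, qExt]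
  field_simp
  ring

theorem iteratedDeriv_hExt_nonneg (hα : ∀ i, -1 < α i) (n : ℕ) :
    0 ≤ iteratedDeriv n (hExt α) 0 := by
  have hF := (differentiable_entireFun hα).analyticAt 0
  have hG := iteratedDeriv_neg_logDeriv hF (iteratedDeriv_entireFun hα) taylorCoeff_zero
  cases n with
  | zero =>
    have := hG 0
    rw [negLogDeriv_taylorCoeff_zero] at this
    simp only [iteratedDeriv_zero, Nat.factorial_zero, Nat.cast_one, one_mul] at this
    -- Subtracting `rate α` = σ_0 makes the constant coefficient 0 and leaves the others unchanged.
    simp [hExt, this]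
  | succ n =>
    have : deriv (hExt α) = deriv fun z => -deriv (entireFun α) z / entireFun α z := by
      funext z
      exact deriv_sub_const _
    rw [iteratedDeriv_succ', this, ← iteratedDeriv_succ', hG]
    exact mul_nonneg (Nat.cast_nonneg _)
      (by exact_mod_cast (powerSumBounds_taylorCoeff hα).nonneg _)

theorem eventually_entireFun_ne_zero (hα : ∀ i, -1 < α i) :
    ∀ᶠ z in 𝓝 (0 : ℂ), entireFun α z ≠ 0 :=
  (differentiable_entireFun hα).continuous.continuousAt.eventually_ne (by simp [entireFun_zero hα])

theorem iteratedDeriv_qExt_nonneg (hα : ∀ i, -1 < α i) (n : ℕ) :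
    0 ≤ iteratedDeriv n (qExt α) 0 := by
  have hne := eventually_entireFun_ne_zero hα
  refine iteratedDeriv_nonneg_of_deriv_eq_mul (H := hExt α) ?_ ?_ ?_ ?_
    (iteratedDeriv_hExt_nonneg hα) n
  · exact Complex.analyticAt_iff_eventually_differentiableAt.2
      (hne.mono fun z hz => differentiableAt_hExt hα hz)
  · exact Complex.analyticAt_iff_eventually_differentiableAt.2
      (hne.mono fun z hz => (hasDerivAt_qExt hα hz).differentiableAt)
  · exact hne.mono fun z hz => (hasDerivAt_qExt hα hz).deriv
  · simp [qExt, entireFun_zero hα]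

theorem exists_isLeast_positiveZeros (hd : 1 ≤ d) (hα : ∀ i, -1 < α i) :
    IsLeast (positiveZeros α) (firstZero α) ∧
      ∀ z : ℂ, ‖z‖ < firstZero α ^ (d + 1) → entireFun α z ≠ 0 := by
  obtain ⟨ρ, hρ, hzero, hmin⟩ := exists_pos_zero_minimal_norm (differentiable_entireFun hα)
    (iteratedDeriv_entireFun hα) taylorCoeff_zero (powerSumBounds_taylorCoeff hα)
    (negLogDeriv_taylorCoeff_one_pos hd hα)
  have hpow : (ρ ^ (((d + 1 : ℕ) : ℝ)⁻¹)) ^ (d + 1) = ρ :=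
    Real.rpow_inv_natCast_pow hρ.le (Nat.succ_ne_zero d)
  have hleast : IsLeast (positiveZeros α) (ρ ^ (((d + 1 : ℕ) : ℝ)⁻¹)) := by
    refine ⟨⟨Real.rpow_pos_of_pos hρ _, ?_⟩, ?_⟩
    · have := entireFun_ofReal_pow (α := α) (ρ ^ (((d + 1 : ℕ) : ℝ)⁻¹))
      rw [hpow, hzero] at this
      exact_mod_cast this.symm
    · rintro z ⟨hz, hz0⟩
      by_contra! hlt
      have hlt' := pow_lt_pow_left₀ hlt hz.le (Nat.succ_ne_zero d)
      rw [hpow] at hlt'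
      refine hmin ((z ^ (d + 1) : ℝ) : ℂ) ?_ ?_
      · rwa [Complex.norm_real, Real.norm_of_nonneg (by positivity)]
      · rw [entireFun_ofReal_pow, hz0, Complex.ofReal_zero]
  have heq : firstZero α = ρ ^ (((d + 1 : ℕ) : ℝ)⁻¹) := hleast.csInf_eq
  rw [heq, hpow]
  exact ⟨hleast, hmin⟩

theorem qFun_zero_pos (hα : ∀ i, -1 < α i) : 0 < qFun α 0 := by
  rw [qFun, if_pos rfl]
  exact mul_pos (Real.rpow_pos_of_pos (by positivity) _)
    (Finset.prod_pos fun i _ => Real.Gamma_pos_of_pos (by linarith [hα i]))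

theorem qExt_zero (hα : ∀ i, -1 < α i) : qExt α 0 = 1 := by
  simp [qExt, entireFun_zero hα]

/-- The prefactor of J at x^(1/(d+1)) contains exactly x^(S/(d+1)), which cancels; the constants
left over form q(0). -/
theorem quotientFormula_eq (hα : ∀ i, -1 < α i) {x : ℝ} (hx : 0 < x) :
    (quotientFormula α x : ℂ) = qFun α 0 * qExt α x := by
  have hd0 : (0 : ℝ) < (d : ℝ) + 1 := by positivity
  have hpow : (x ^ (1 / ((d : ℝ) + 1))) ^ (d + 1) = x := by
    have := Real.rpow_inv_natCast_pow hx.le (Nat.succ_ne_zero d)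
    rwa [Nat.cast_succ, ← one_div] at this
  have hF := entireFun_ofReal_pow (α := α) (x ^ (1 / ((d : ℝ) + 1)))
  rw [hpow] at hF
  have hexp : -x / (((d : ℝ) + 1) ^ (d + 1) * prodParam α) = -(rate α * x) := by
    rw [rate]
    ring
  have hr : (x ^ (1 / ((d : ℝ) + 1)) / ((d : ℝ) + 1)) ^ sumParam α =
      x ^ (sumParam α / ((d : ℝ) + 1)) / ((d : ℝ) + 1) ^ sumParam α := by
    rw [Real.div_rpow (Real.rpow_nonneg hx.le _) hd0.le, ← Real.rpow_mul hx.le]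
    congr 2
    ring
  have hx' : 0 < x ^ (sumParam α / ((d : ℝ) + 1)) := Real.rpow_pos_of_pos hx _
  have hΓ : 0 < ∏ i, Real.Gamma (α i + 1) :=
    Finset.prod_pos fun i _ => Real.Gamma_pos_of_pos (by linarith [hα i])
  have hdS : 0 < ((d : ℝ) + 1) ^ sumParam α := Real.rpow_pos_of_pos hd0 _
  rw [qExt, hF, qFun, if_pos rfl, quotientFormula, hyperBessel, hexp, hr]
  norm_cast
  rw [← div_div, ← mul_div_assoc]
  congr 1
  field_simp

theorem qFun_eq (hα : ∀ i, -1 < α i) {x : ℝ} (hx : 0 ≤ x) :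
    (qFun α x : ℂ) = qFun α 0 * qExt α x := by
  rcases hx.eq_or_lt with rfl | hx
  · simp [qExt_zero hα]
  · rw [← quotientFormula_eq hα hx, qFun, if_neg hx.ne']

theorem qFun_eq_re (hα : ∀ i, -1 < α i) {x : ℝ} (hx : 0 ≤ x) :
    qFun α x = ((qFun α 0 : ℂ) * qExt α x).re := by
  rw [← qFun_eq hα hx, Complex.ofReal_re]

theorem hasDerivWithinAt_log_qFun (hα : ∀ i, -1 < α i) {x : ℝ} (hx : 0 ≤ x)
    (hpos : 0 < qFun α x) (hne : entireFun α x ≠ 0) :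
    HasDerivWithinAt (fun t => Real.log (qFun α t)) (hExt α x).re (Ici 0) x := by
  have h1 := ((hasDerivAt_qExt hα hne).const_mul (qFun α 0 : ℂ)).real_of_complex
  have h2 : HasDerivWithinAt (qFun α) ((qFun α 0 : ℂ) * (hExt α x * qExt α x)).re (Ici 0) x :=
    h1.hasDerivWithinAt.congr (fun t ht => qFun_eq_re hα ht) (qFun_eq_re hα hx)
  convert! h2.log hpos.ne' using 1
  rw [eq_div_iff hpos.ne', mul_left_comm, ← qFun_eq hα hx, Complex.re_mul_ofReal]

end

end HyperBessel

open scoped ComplexOrder in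
theorem theorem6 {d : ℕ} (hd : 1 ≤ d) (α : Fin d → ℝ) (hα : ∀ i, -1 < α i) :
    -- the first positive zero exists
    IsLeast (HyperBessel.positiveZeros α) (HyperBessel.firstZero α) ∧
    -- the value of `q` at `0` is the limit of the defining quotient
    Tendsto (HyperBessel.quotientFormula α) (𝓝[>] 0) (𝓝 (HyperBessel.qFun α 0)) ∧
    -- `q` is positive, and `log q` is differentiable, so that `h` is a genuine derivative
    (∀ x ∈ Ico (0 : ℝ) (HyperBessel.firstZero α ^ (d + 1)), 0 < HyperBessel.qFun α x) ∧
    (∀ x ∈ Ico (0 : ℝ) (HyperBessel.firstZero α ^ (d + 1)),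
      HasDerivWithinAt (fun t => Real.log (HyperBessel.qFun α t))
        (HyperBessel.hFun α x) (Ici 0) x) ∧
    -- the two assertions
    AbsolutelyMonotoneOn (HyperBessel.hFun α)
      (Ico (0 : ℝ) (HyperBessel.firstZero α ^ (d + 1))) ∧
    AbsolutelyMonotoneOn (HyperBessel.qFun α)
      (Ico (0 : ℝ) (HyperBessel.firstZero α ^ (d + 1))) := by
  obtain ⟨hleast, hne⟩ := HyperBessel.exists_isLeast_positiveZeros hd hα
  set R := HyperBessel.firstZero α ^ (d + 1) with hR
  have hC := HyperBessel.qFun_zero_pos hα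
  have hball : ∀ z ∈ Metric.ball (0 : ℂ) R, HyperBessel.entireFun α z ≠ 0 := fun z hz =>
    hne z (by simpa using hz)
  have hreal : ∀ x ∈ Ico 0 R, HyperBessel.entireFun α (x : ℂ) ≠ 0 := fun x hx =>
    hne x (by rw [Complex.norm_real, Real.norm_of_nonneg hx.1]; exact hx.2)
  have hq : DifferentiableOn ℂ
      (fun z => (HyperBessel.qFun α 0 : ℂ) * HyperBessel.qExt α z) (Metric.ball 0 R) := fun z hz =>
    ((HyperBessel.hasDerivAt_qExt hα (hball z hz)).const_mul
      _).differentiableAt.differentiableWithinAt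
  have hqn : ∀ n, 0 ≤ iteratedDeriv n
      (fun z => (HyperBessel.qFun α 0 : ℂ) * HyperBessel.qExt α z) 0 := fun n => by
    rw [iteratedDeriv_const_mul_field]
    exact mul_nonneg (by exact_mod_cast hC.le) (HyperBessel.iteratedDeriv_qExt_nonneg hα n)
  have hpos : ∀ x ∈ Ico 0 R, 0 < HyperBessel.qFun α x := by
    intro x hx
    have h0 := hq.nonneg_of_iteratedDeriv_nonneg hqn (z := (x : ℂ)) (by exact_mod_cast hx.1)
      (by simpa [abs_of_nonneg hx.1] using hx.2)
    rw [← HyperBessel.qFun_eq hα hx.1] at h0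
    -- Nonnegativity comes from the Taylor coefficients, strictness from the exponential in the
    -- numerator never vanishing.
    refine lt_of_le_of_ne (by exact_mod_cast h0) fun h => ?_
    have := HyperBessel.qFun_eq hα hx.1
    rw [← h, HyperBessel.qExt, Complex.ofReal_zero, eq_comm, mul_eq_zero, div_eq_zero_iff] at this
    rcases this with h | h | h
    · exact hC.ne' (by exact_mod_cast h)
    · exact Complex.exp_ne_zero _ h
    · exact hreal x hx h
  have hderiv : ∀ x ∈ Ico 0 R, HasDerivWithinAt (fun t => Real.log (HyperBessel.qFun α t))
      (HyperBessel.hExt α x).re (Ici 0) x := fun x hx =>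
    HyperBessel.hasDerivWithinAt_log_qFun hα hx.1 (hpos x hx) (hreal x hx)
  have hh : ∀ x ∈ Ico 0 R, HyperBessel.hFun α x = (HyperBessel.hExt α x).re := fun x hx =>
    (hderiv x hx).derivWithin (uniqueDiffOn_Ici 0 x hx.1)
  refine ⟨hleast, ?_, hpos, fun x hx => ?_, ?_, ?_⟩
  · have hcont : ContinuousAt (fun z => ((HyperBessel.qFun α 0 : ℂ) * HyperBessel.qExt α z).re)
        ((0 : ℝ) : ℂ) := by
      rw [Complex.ofReal_zero]
      exact Complex.continuous_re.continuousAt.comp ((HyperBessel.hasDerivAt_qExt hα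
        (by simp [HyperBessel.entireFun_zero hα])).continuousAt.const_mul _)
    have := (hcont.comp Complex.continuous_ofReal.continuousAt).tendsto.mono_left
      (nhdsWithin_le_nhds (s := Ioi 0))
    simp only [Function.comp_apply, ← HyperBessel.qFun_eq hα le_rfl, Complex.ofReal_re] at this
    refine this.congr' ?_
    filter_upwards [self_mem_nhdsWithin] with x hx
    rw [Function.comp_apply, ← HyperBessel.quotientFormula_eq hα hx, Complex.ofReal_re]
  · rw [hh x hx]
    exact hderiv x hx
  · exact absolutelyMonotoneOn_of_iteratedDeriv_nonneg
      (fun z hz => (HyperBessel.differentiableAt_hExt hα (hball z hz)).differentiableWithinAt)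
      (HyperBessel.iteratedDeriv_hExt_nonneg hα) hh
  · exact absolutelyMonotoneOn_of_iteratedDeriv_nonneg hq hqn
      fun x hx => HyperBessel.qFun_eq_re hα hx.1
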